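/- Let $\gamma,\mu,\nu,b\in\mathbb{R}$ with $\nu\ge 0$, $2+\mu-\gamma>0$ and $b>0$. Let $J_\nu$ be the Bessel function of the first kind of order $\nu$. Then $J_\nu$ has a least positive zero; denote it by $j_{\nu,1}$. (i) For every complex-valued $f\in C_0^\infty((0,b))$ (infinitely differentiable with compact support in $(0,b)$), $$\int_0^b x^\gamma |f'(x)|^2\,dx \;\ge\; \frac{(1-\gamma)^2-(2+\mu-\gamma)^2\nu^2}{4}\int_0^b x^{\gamma-2}|f(x)|^2\,dx+\frac{j_{\nu,1}^2(2+\mu-\gamma)^2}{4b^{2+\mu-\gamma}}\int_0^b x^\mu |f(x)|^2\,dx .$$ (ii) If $0\le \nu<|1-\gamma|/(2+\mu-\gamma)$, then the first coefficient on the right-hand side, $\frac{(1-\gamma)^2-(2+\mu-\gamma)^2\nu^2}{4}$, is positive. (iii) Let $w(x)=J_\nu\big(j_{\nu,1}(x/b)^{(2+\mu-\gamma)/2}\big)$ for $x\in(0,b)$. Then $w$ is positive and differentiable on $(0,b)$, and the functions $$a_1(x)=x^{\gamma/2},\qquad a_0(x)=\frac{\gamma-1}{2}x^{\gamma/2-1}-x^{\gamma/2}\,\frac{w'(x)}{w(x)}$$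 are such that $a_0a_1$ is differentiable on $(0,b)$ and $$-a_0(x)^2+\big[a_0(x)a_1(x)\big]'=\frac{(1-\gamma)^2-(2+\mu-\gamma)^2\nu^2}{4}x^{\gamma-2}+\frac{j_{\nu,1}^2(2+\mu-\gamma)^2}{4b^{2+\mu-\gamma}}x^{\mu},\qquad x\in(0,b).$$ -/

import Mathlib

open MeasureTheory Set
open scoped ContDiff

/-- The Bessel function of the first kind `J_ν(x)` for `x ≥ 0`, by its standard power series
`(x/2)^ν ∑_k (-1)^k (x²/4)^k / (k! Γ(ν+k+1))`. -/
noncomputable def besselJ (ν x : ℝ) : ℝ :=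
  (x / 2) ^ ν *
    ∑' k : ℕ, (-1 : ℝ) ^ k * (x ^ 2 / 4) ^ k / ((k.factorial : ℝ) * Real.Gamma (ν + k + 1))

/-- The set of positive zeros of `J_ν`. -/
def besselJPosZeros (ν : ℝ) : Set ℝ := {x : ℝ | 0 < x ∧ besselJ ν x = 0}

/-- The first positive zero `j_{ν,1}` of `J_ν`. -/
noncomputable def besselJFirstZero (ν : ℝ) : ℝ := sInf (besselJPosZeros ν)

/-- `f ∈ C_0^∞((a,b))`, complex valued, with `f` extended by zero to the real line. -/
def IsTestFunctionOn (a b : ℝ) (f : ℝ → ℂ) : Prop :=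
  ContDiff ℝ ∞ f ∧ HasCompactSupport f ∧ tsupport f ⊆ Ioo a b

/-- The function `x ↦ J_ν(j_{ν,1} (x/b)^{(2+μ-γ)/2})`. -/
noncomputable def scaledBesselJ (γ μ ν b x : ℝ) : ℝ :=
  besselJ ν (besselJFirstZero ν * (x / b) ^ ((2 + μ - γ) / 2))

/-- The coefficient `a_1(x) = x^{γ/2}`. -/
noncomputable def coeffA1 (γ x : ℝ) : ℝ := x ^ (γ / 2)

/-- The coefficient
`a_0(x) = ((γ-1)/2) x^{γ/2-1} - x^{γ/2} [J_ν(j_{ν,1}(x/b)^{(2+μ-γ)/2})]' /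
J_ν(j_{ν,1}(x/b)^{(2+μ-γ)/2})`. -/
noncomputable def coeffA0 (γ μ ν b x : ℝ) : ℝ :=
  (γ - 1) / 2 * x ^ (γ / 2 - 1)
    - x ^ (γ / 2) * (deriv (scaledBesselJ γ μ ν b) x / scaledBesselJ γ μ ν b x)

/-! The inequality is `∫ |a₁ f' + a₀ f|² ≥ 0`: the cross term `a₀ a₁ (|f|²)'` is integrated by
parts, without boundary terms since `f` vanishes near `0` and `b`. The weight `-a₀² + (a₀ a₁)'` that
appears is explicit because `q = x w' / w` solves a Riccati equation (`hasDerivAt_besselQuot`),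
which is Bessel's equation in logarithmic form.

Bessel's equation is handled through the entire factor `g = besselSeries ν`, for which `g_ν' =
-g_{ν+1}` and `besselSeries_recurrence` together say `t g'' + (ν + 1) g' + g = 0`. A Sturm
comparison shows that `g` has a positive zero, and continuity then gives a least one. Before it `g >
0`, hence `w > 0` on `(0, b)`. -/

/-! ### The entire factor of `J_ν` and its differential equation -/

/-- The entire function `∑ₖ (-t)ᵏ / (k! Γ(ν+k+1))`, with
`J_ν(x) = (x/2)^ν besselSeries ν (x²/4)`. -/
noncomputable def besselSeries (ν t : ℝ) : ℝ :=
  ∑' k : ℕ, (-1 : ℝ) ^ k * t ^ k / ((k.factorial : ℝ) * Real.Gamma (ν + k + 1))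

theorem besselJ_eq_rpow_mul_besselSeries (ν x : ℝ) :
    besselJ ν x = (x / 2) ^ ν * besselSeries ν (x ^ 2 / 4) := rfl

theorem gamma_le_gamma_add_nat {ν : ℝ} (hν : 0 ≤ ν) (k : ℕ) :
    Real.Gamma (ν + 1) ≤ Real.Gamma (ν + k + 1) := by
  induction k with
  | zero => simp
  | succ k ih =>
    have hk : (0 : ℝ) ≤ k := k.cast_nonneg
    have hpos : 0 < Real.Gamma (ν + k + 1) := Real.Gamma_pos_of_pos (by linarith)
    have h := Real.Gamma_add_one (s := ν + k + 1) (by linarith)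
    push_cast
    rw [← add_assoc, h]
    nlinarith

theorem abs_besselSeries_term_le {ν : ℝ} (hν : 0 ≤ ν) (t : ℝ) (k : ℕ) :
    ‖(-1 : ℝ) ^ k * t ^ k / ((k.factorial : ℝ) * Real.Gamma (ν + k + 1))‖
      ≤ |t| ^ k / k.factorial * (Real.Gamma (ν + 1))⁻¹ := by
  have hpos : 0 < Real.Gamma (ν + 1) := Real.Gamma_pos_of_pos (by linarith)
  have hle := gamma_le_gamma_add_nat hν k
  have hpos' := hpos.trans_le hle
  rw [Real.norm_eq_abs, abs_div, abs_mul, abs_pow, abs_pow, abs_neg, abs_one, one_pow, one_mul,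
    abs_of_pos (mul_pos (by positivity) hpos'), div_mul_eq_div_div, div_eq_mul_inv (_ / _)]
  gcongr

theorem summable_besselSeries {ν : ℝ} (hν : 0 ≤ ν) (t : ℝ) :
    Summable fun k : ℕ ↦
      (-1 : ℝ) ^ k * t ^ k / ((k.factorial : ℝ) * Real.Gamma (ν + k + 1)) :=
  .of_norm_bounded ((Real.summable_pow_div_factorial |t|).mul_right _)
    (abs_besselSeries_term_le hν t)

theorem abs_besselSeries_term_deriv_le {ν r y : ℝ} (hν : 0 ≤ ν) (hy : |y| ≤ r) (k : ℕ) :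
    ‖(-1 : ℝ) ^ k * (k * y ^ (k - 1)) / ((k.factorial : ℝ) * Real.Gamma (ν + k + 1))‖
      ≤ (k : ℝ) * r ^ (k - 1) / k.factorial * (Real.Gamma (ν + 1))⁻¹ := by
  have hpos : 0 < Real.Gamma (ν + 1) := Real.Gamma_pos_of_pos (by linarith)
  have hle := gamma_le_gamma_add_nat hν k
  have hpos' := hpos.trans_le hle
  have hr : 0 ≤ r := (abs_nonneg y).trans hy
  rw [Real.norm_eq_abs, abs_div, abs_mul, abs_pow, abs_mul, abs_pow, abs_neg, abs_one, one_pow,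
    one_mul, Nat.abs_cast, abs_of_pos (mul_pos (by positivity) hpos'), div_mul_eq_div_div,
    div_eq_mul_inv (_ / _)]
  gcongr

theorem hasDerivAt_besselSeries {ν : ℝ} (hν : 0 ≤ ν) (t : ℝ) :
    HasDerivAt (besselSeries ν) (-besselSeries (ν + 1) t) t := by
  have hpos : 0 < Real.Gamma (ν + 1) := Real.Gamma_pos_of_pos (by linarith)
  have hu : Summable fun k : ℕ ↦
      (k : ℝ) * (|t| + 1) ^ (k - 1) / k.factorial * (Real.Gamma (ν + 1))⁻¹ := by
    refine Summable.mul_right _ ?_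
    rw [← summable_nat_add_iff 1]
    refine (Real.summable_pow_div_factorial (|t| + 1)).congr fun k ↦ ?_
    rw [Nat.factorial_succ]
    push_cast
    field_simp
  have key := hasDerivAt_tsum_of_isPreconnected
    (g := fun (k : ℕ) (y : ℝ) ↦
      (-1 : ℝ) ^ k * y ^ k / ((k.factorial : ℝ) * Real.Gamma (ν + k + 1)))
    (g' := fun (k : ℕ) (y : ℝ) ↦
      (-1 : ℝ) ^ k * (k * y ^ (k - 1)) / ((k.factorial : ℝ) * Real.Gamma (ν + k + 1)))
    (t := Metric.ball 0 (|t| + 1)) (y₀ := 0) (y := t) hu Metric.isOpen_ball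
    (convex_ball _ _).isPreconnected
    (fun k y _ ↦ (((hasDerivAt_pow k y).const_mul _).div_const _))
    (fun k y hy ↦ ?_) (by simpa using by positivity) (summable_besselSeries hν 0) (by simp)
  · refine key.congr_deriv ?_
    -- The factor `k` kills the term `k = 0`, so the truncated exponent `k - 1` is harmless and the
    -- index can be shifted.
    rw [(Summable.of_norm_bounded hu fun k ↦ ?_).tsum_eq_zero_add, besselSeries, ← tsum_neg]
    · simp only [Nat.cast_zero, zero_mul, mul_zero, zero_div, zero_add]
      refine tsum_congr fun k ↦ ?_
      have hk : (0 : ℝ) ≤ k := k.cast_nonneg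
      have h1 : 0 < Real.Gamma (ν + 1 + k + 1) := Real.Gamma_pos_of_pos (by linarith)
      rw [Nat.factorial_succ, Nat.add_sub_cancel]
      push_cast
      rw [show ν + (k + 1 : ℝ) + 1 = ν + 1 + k + 1 by ring]
      field_simp
      ring
    · exact abs_besselSeries_term_deriv_le hν (by linarith) k
  · exact abs_besselSeries_term_deriv_le hν (by simpa using (mem_ball_zero_iff.1 hy).le) k

/-- Coefficientwise, `1/Γ(ν+k+1) - (ν+1)/Γ(ν+k+2) = k/Γ(ν+k+2)`, and the factor `k` cancels against
`k!`, shifting the series by one. -/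
theorem besselSeries_recurrence {ν : ℝ} (hν : 0 ≤ ν) (t : ℝ) :
    t * besselSeries (ν + 2) t - (ν + 1) * besselSeries (ν + 1) t + besselSeries ν t = 0 := by
  have h0 := summable_besselSeries hν t
  have h1 := (summable_besselSeries (by linarith : 0 ≤ ν + 1) t)
  have hstep (k : ℕ) : Real.Gamma (ν + 1 + k + 1) = (ν + k + 1) * Real.Gamma (ν + k + 1) := by
    rw [← Real.Gamma_add_one (by positivity)]
    ring_nf
  have hdiff : besselSeries ν t - (ν + 1) * besselSeries (ν + 1) t =
      ∑' k : ℕ, (-1 : ℝ) ^ k * k * t ^ k / (k.factorial * Real.Gamma (ν + 1 + k + 1)) := by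
    rw [besselSeries, besselSeries, ← tsum_mul_left, ← h0.tsum_sub (h1.mul_left _)]
    refine tsum_congr fun k ↦ ?_
    have hpos : 0 < Real.Gamma (ν + k + 1) := Real.Gamma_pos_of_pos (by positivity)
    have hk : 0 < ν + k + 1 := by positivity
    rw [hstep]
    field_simp
    ring
  have hs : Summable fun k : ℕ ↦
      (-1 : ℝ) ^ k * k * t ^ k / (k.factorial * Real.Gamma (ν + 1 + k + 1)) := by
    refine (h0.sub (h1.mul_left (ν + 1))).congr fun k ↦ ?_
    have hpos : 0 < Real.Gamma (ν + k + 1) := Real.Gamma_pos_of_pos (by positivity)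
    have hk : 0 < ν + k + 1 := by positivity
    rw [hstep]
    field_simp
    ring
  have hshift : ∑' k : ℕ, (-1 : ℝ) ^ k * k * t ^ k / (k.factorial * Real.Gamma (ν + 1 + k + 1)) =
      -(t * besselSeries (ν + 2) t) := by
    rw [hs.tsum_eq_zero_add, besselSeries, ← tsum_mul_left, ← tsum_neg]
    simp only [Nat.cast_zero, zero_mul, mul_zero, zero_div, zero_add]
    refine tsum_congr fun k ↦ ?_
    have hpos : 0 < Real.Gamma (ν + 2 + k + 1) := Real.Gamma_pos_of_pos (by positivity)
    rw [Nat.factorial_succ]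
    push_cast
    rw [show ν + 1 + (k + 1 : ℝ) + 1 = ν + 2 + k + 1 by ring]
    field_simp
    ring
  linarith

/-! ### The first positive zero -/

theorem continuous_besselSeries {ν : ℝ} (hν : 0 ≤ ν) : Continuous (besselSeries ν) :=
  continuous_iff_continuousAt.2 fun t ↦ (hasDerivAt_besselSeries hν t).continuousAt

theorem besselSeries_zero_pos {ν : ℝ} (hν : 0 ≤ ν) : 0 < besselSeries ν 0 := by
  rw [besselSeries, tsum_eq_single 0 fun k hk ↦ by simp [hk]]
  have : 0 < Real.Gamma (ν + 1) := Real.Gamma_pos_of_pos (by linarith)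
  simpa using this

theorem besselSeries_pos_of_ne_zero {ν T : ℝ} (hν : 0 ≤ ν) (hT : 0 ≤ T)
    (h : ∀ t ∈ Icc 0 T, besselSeries ν t ≠ 0) : 0 < besselSeries ν T := by
  by_contra! hle
  obtain ⟨t, ht, h0⟩ := intermediate_value_Icc' hT (continuous_besselSeries hν).continuousOn
    ⟨hle, (besselSeries_zero_pos hν).le⟩
  exact h t ht h0

/-- Sturm comparison with `φ = (R - t)²`: if `g` had no zero, the weighted Wronskian `W = t^(ν+1)
(g' φ - g φ')` would be strictly decreasing on `[0, R]`, yet it vanishes at both ends. -/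
theorem exists_pos_besselSeries_eq_zero {ν : ℝ} (hν : 0 ≤ ν) :
    ∃ t, 0 < t ∧ besselSeries ν t = 0 := by
  by_contra! hne
  have hpos (t : ℝ) (ht : 0 ≤ t) : 0 < besselSeries ν t := by
    refine besselSeries_pos_of_ne_zero hν ht fun s hs ↦ ?_
    rcases hs.1.eq_or_lt with rfl | h
    · exact (besselSeries_zero_pos hν).ne'
    · exact hne s h
  -- Any `R` with `2 R > (ν + 2)²` makes the bracket in `W'` positive.
  set R : ℝ := (ν + 2) ^ 2 with hR
  have hRpos : 0 < R := by positivity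
  set W : ℝ → ℝ := fun t ↦ t ^ (ν + 1) *
    (-besselSeries (ν + 1) t * (R - t) ^ 2 + besselSeries ν t * (2 * (R - t))) with hW
  have hcont : ContinuousOn W (Icc 0 R) := by
    have c0 := continuous_besselSeries hν
    have c1 := continuous_besselSeries (by linarith : 0 ≤ ν + 1)
    have c2 : Continuous fun t : ℝ ↦ t ^ (ν + 1) := Real.continuous_rpow_const (by linarith)
    exact (by fun_prop : Continuous W).continuousOn
  have hanti : StrictAntiOn W (Icc 0 R) := by
    refine strictAntiOn_of_deriv_neg (convex_Icc 0 R) hcont fun t ht ↦ ?_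
    rw [interior_Icc] at ht
    have ht0 : 0 < t := ht.1
    have d0 := hasDerivAt_besselSeries hν t
    have d1 := hasDerivAt_besselSeries (by linarith : 0 ≤ ν + 1) t
    have dR := (hasDerivAt_id t).const_sub R
    have dp := Real.hasDerivAt_rpow_const (x := t) (p := ν + 1) (.inl ht0.ne')
    have d := dp.mul ((d1.neg.mul (dR.pow 2)).add (d0.mul (dR.const_mul 2)))
    have hrec := besselSeries_recurrence hν t
    have hWd : HasDerivAt W (-(t ^ ν * besselSeries ν t *
        ((R - t - (ν + 2)) ^ 2 + 2 * R - (ν + 2) ^ 2))) t := by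
      refine (d.congr_of_eventuallyEq ?_).congr_deriv ?_
      · exact .of_forall fun s ↦ by simp [hW]
      · simp only [Pi.mul_apply, Pi.add_apply, Pi.neg_apply, Pi.pow_apply, id]
        rw [show ν + 1 - 1 = ν by ring, Real.rpow_add_one ht0.ne',
          show ν + 1 + 1 = ν + 2 by ring]
        push_cast
        linear_combination (t ^ ν * (R - t) ^ 2) * hrec
    rw [hWd.deriv, neg_neg_iff_pos]
    have := Real.rpow_pos_of_pos ht0 ν
    have := hpos t ht0.le
    have : 0 < (R - t - (ν + 2)) ^ 2 + 2 * R - (ν + 2) ^ 2 := by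
      rw [← hR]; nlinarith [sq_nonneg (R - t - (ν + 2))]
    positivity
  have h := hanti (left_mem_Icc.2 hRpos.le) (right_mem_Icc.2 hRpos.le) hRpos
  have hW0 : W 0 = 0 := by
    simp only [hW]
    rw [Real.zero_rpow (by linarith), zero_mul]
  have hWR : W R = 0 := by simp [hW]
  linarith

/-- Since `g(0) ≠ 0`, the condition `0 < x` relaxes to `0 ≤ x`, which makes the zero set visibly
closed. -/
theorem besselJPosZeros_eq {ν : ℝ} (hν : 0 ≤ ν) :
    besselJPosZeros ν = {x : ℝ | 0 ≤ x ∧ besselSeries ν (x ^ 2 / 4) = 0} := by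
  ext x
  rw [besselJPosZeros, mem_ofPred_eq, mem_ofPred_eq, besselJ_eq_rpow_mul_besselSeries]
  constructor
  · rintro ⟨hx, h⟩
    exact ⟨hx.le, (mul_eq_zero.1 h).resolve_left (Real.rpow_pos_of_pos (by linarith) ν).ne'⟩
  · rintro ⟨hx, h⟩
    refine ⟨hx.lt_of_ne ?_, by rw [h, mul_zero]⟩
    rintro rfl
    have := besselSeries_zero_pos hν
    norm_num at h
    linarith

theorem isLeast_besselJFirstZero {ν : ℝ} (hν : 0 ≤ ν) :
    IsLeast (besselJPosZeros ν) (besselJFirstZero ν) := by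
  have hbdd : BddBelow (besselJPosZeros ν) := ⟨0, fun x hx ↦ hx.1.le⟩
  have hne : (besselJPosZeros ν).Nonempty := by
    obtain ⟨t, ht, h0⟩ := exists_pos_besselSeries_eq_zero hν
    rw [besselJPosZeros_eq hν]
    refine ⟨2 * √t, by positivity, ?_⟩
    rwa [mul_pow, Real.sq_sqrt ht.le, show (2 : ℝ) ^ 2 * t / 4 = t by ring]
  have hclosed : IsClosed (besselJPosZeros ν) := by
    rw [besselJPosZeros_eq hν]
    have c0 := continuous_besselSeries hν
    exact isClosed_Ici.inter (isClosed_eq (by fun_prop) continuous_const)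
  exact ⟨hclosed.csInf_mem hne hbdd, fun x hx ↦ csInf_le hbdd hx⟩

theorem besselSeries_pos_of_lt {ν t : ℝ} (hν : 0 ≤ ν) (ht : 0 ≤ t)
    (h : t < besselJFirstZero ν ^ 2 / 4) : 0 < besselSeries ν t := by
  have hleast := isLeast_besselJFirstZero hν
  refine besselSeries_pos_of_ne_zero hν ht fun s hs h0 ↦ ?_
  have hmem : 2 * √s ∈ besselJPosZeros ν := by
    rw [besselJPosZeros_eq hν]
    refine ⟨by positivity, ?_⟩
    rwa [mul_pow, Real.sq_sqrt hs.1, show (2 : ℝ) ^ 2 * s / 4 = s by ring]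
  have h1 := pow_le_pow_left₀ hleast.1.1.le (hleast.2 hmem) 2
  rw [mul_pow, Real.sq_sqrt hs.1] at h1
  linarith [hs.2]

/-! ### The rescaled Bessel function and its Riccati equation -/

theorem scaledBesselJ_eq {γ μ ν b x : ℝ} (hν : 0 ≤ ν) (hb : 0 < b) (hx : 0 < x) :
    scaledBesselJ γ μ ν b x =
      (besselJFirstZero ν / 2) ^ ν * (x / b) ^ ((2 + μ - γ) / 2 * ν) *
        besselSeries ν (besselJFirstZero ν ^ 2 / 4 * (x / b) ^ (2 + μ - γ)) := by
  have hxb : 0 < x / b := div_pos hx hb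
  have hj : 0 < besselJFirstZero ν := (isLeast_besselJFirstZero hν).1.1
  have hsq : ((x / b) ^ ((2 + μ - γ) / 2)) ^ 2 = (x / b) ^ (2 + μ - γ) := by
    rw [← Real.rpow_natCast, ← Real.rpow_mul hxb.le]
    push_cast
    ring_nf
  rw [scaledBesselJ, besselJ_eq_rpow_mul_besselSeries, mul_pow, hsq, mul_div_right_comm,
    mul_div_right_comm, Real.mul_rpow (by positivity) (by positivity), ← Real.rpow_mul hxb.le]

/-- The argument of `besselSeries` in `scaledBesselJ_eq`. -/
noncomputable def besselArg (γ μ ν b x : ℝ) : ℝ :=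
  besselJFirstZero ν ^ 2 / 4 * (x / b) ^ (2 + μ - γ)

theorem hasDerivAt_div_rpow {b x : ℝ} (hb : 0 < b) (hx : 0 < x) (p : ℝ) :
    HasDerivAt (fun y ↦ (y / b) ^ p) (p * (x / b) ^ p / x) x := by
  have hxb : 0 < x / b := div_pos hx hb
  refine (((hasDerivAt_id x).div_const b).rpow_const (p := p) (.inl hxb.ne')).congr_deriv ?_
  simp only [id]
  rw [Real.rpow_sub_one hxb.ne']
  field_simp

theorem hasDerivAt_besselArg {γ μ ν b x : ℝ} (hb : 0 < b) (hx : 0 < x) :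
    HasDerivAt (besselArg γ μ ν b) ((2 + μ - γ) * besselArg γ μ ν b x / x) x :=
  ((hasDerivAt_div_rpow hb hx (2 + μ - γ)).const_mul (besselJFirstZero ν ^ 2 / 4)).congr_deriv
    (by rw [besselArg]; ring)

theorem besselSeries_besselArg_pos {γ μ ν b x : ℝ} (hν : 0 ≤ ν) (hμγ : 0 < 2 + μ - γ)
    (hx : x ∈ Ioo 0 b) : 0 < besselSeries ν (besselArg γ μ ν b x) := by
  have hb : 0 < b := hx.1.trans hx.2
  have hxb : 0 < x / b := div_pos hx.1 hb
  have hj : 0 < besselJFirstZero ν := (isLeast_besselJFirstZero hν).1.1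
  refine besselSeries_pos_of_lt hν (by rw [besselArg]; positivity) ?_
  exact mul_lt_of_lt_one_right (by positivity)
    (Real.rpow_lt_one hxb.le ((div_lt_one hb).2 hx.2) hμγ)

theorem scaledBesselJ_pos {γ μ ν b x : ℝ} (hν : 0 ≤ ν) (hμγ : 0 < 2 + μ - γ)
    (hx : x ∈ Ioo 0 b) : 0 < scaledBesselJ γ μ ν b x := by
  have hb : 0 < b := hx.1.trans hx.2
  have hxb : 0 < x / b := div_pos hx.1 hb
  have hj : 0 < besselJFirstZero ν := (isLeast_besselJFirstZero hν).1.1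
  have hg := besselSeries_besselArg_pos hν hμγ hx
  rw [scaledBesselJ_eq hν hb hx.1]
  exact mul_pos (by positivity) hg

/-- The quotient `x w'(x)/w(x)` for `w = scaledBesselJ γ μ ν b`. -/
noncomputable def besselQuot (γ μ ν b x : ℝ) : ℝ :=
  (2 + μ - γ) / 2 * ν - (2 + μ - γ) * besselArg γ μ ν b x *
    (besselSeries (ν + 1) (besselArg γ μ ν b x) / besselSeries ν (besselArg γ μ ν b x))

theorem hasDerivAt_scaledBesselJ {γ μ ν b x : ℝ} (hν : 0 ≤ ν) (hμγ : 0 < 2 + μ - γ)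
    (hx : x ∈ Ioo 0 b) :
    HasDerivAt (scaledBesselJ γ μ ν b)
      (besselQuot γ μ ν b x / x * scaledBesselJ γ μ ν b x) x := by
  have hb : 0 < b := hx.1.trans hx.2
  have hx0 : 0 < x := hx.1
  have hg := besselSeries_besselArg_pos hν hμγ hx
  have d := ((hasDerivAt_div_rpow hb hx0 ((2 + μ - γ) / 2 * ν)).const_mul
    ((besselJFirstZero ν / 2) ^ ν)).mul ((hasDerivAt_besselSeries hν _).comp x
      (hasDerivAt_besselArg (γ := γ) (μ := μ) (ν := ν) hb hx0))
  refine (d.congr_of_eventuallyEq ?_).congr_deriv ?_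
  · filter_upwards [Ioi_mem_nhds hx0] with y hy
    exact scaledBesselJ_eq hν hb hy
  · rw [scaledBesselJ_eq hν hb hx0, ← besselArg, besselQuot]
    simp only [Function.comp_apply]
    field_simp
    ring

/-- The Riccati equation of `q`; the recurrence eliminates `besselSeries (ν + 2)`. -/
theorem hasDerivAt_besselQuot {γ μ ν b x : ℝ} (hν : 0 ≤ ν) (hμγ : 0 < 2 + μ - γ)
    (hx : x ∈ Ioo 0 b) :
    HasDerivAt (besselQuot γ μ ν b)
      (((2 + μ - γ) ^ 2 * ν ^ 2 / 4 - (2 + μ - γ) ^ 2 * besselArg γ μ ν b x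
        - besselQuot γ μ ν b x ^ 2) / x) x := by
  have hb : 0 < b := hx.1.trans hx.2
  have hx0 : 0 < x := hx.1
  have hg := besselSeries_besselArg_pos hν hμγ hx
  have dt := hasDerivAt_besselArg (γ := γ) (μ := μ) (ν := ν) hb hx0
  have d0 := (hasDerivAt_besselSeries hν _).comp x dt
  have d1 := (hasDerivAt_besselSeries (by linarith : 0 ≤ ν + 1) _).comp x dt
  have d := ((dt.const_mul (2 + μ - γ)).mul (d1.div d0 hg.ne')).const_sub ((2 + μ - γ) / 2 * ν)
  have hrec := besselSeries_recurrence hν (besselArg γ μ ν b x)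
  refine (d.congr_of_eventuallyEq (.of_forall fun y ↦ rfl)).congr_deriv ?_
  simp only [besselQuot, Function.comp_apply, Pi.div_apply]
  rw [show ν + 1 + 1 = ν + 2 by ring]
  generalize besselArg γ μ ν b x = t at *
  generalize besselSeries (ν + 2) t = g2 at *
  generalize besselSeries (ν + 1) t = g1 at *
  generalize besselSeries ν t = g0 at *
  generalize 2 + μ - γ = δ at *
  field_simp
  linear_combination (16 * t * g0) * hrec

/-! ### The coefficients of the factorization -/

theorem coeffA0_eq {γ μ ν b x : ℝ} (hν : 0 ≤ ν) (hμγ : 0 < 2 + μ - γ) (hx : x ∈ Ioo 0 b) :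
    coeffA0 γ μ ν b x = ((γ - 1) / 2 - besselQuot γ μ ν b x) * x ^ (γ / 2 - 1) := by
  have hx0 : 0 < x := hx.1
  rw [coeffA0, (hasDerivAt_scaledBesselJ hν hμγ hx).deriv,
    mul_div_cancel_right₀ _ (scaledBesselJ_pos hν hμγ hx).ne', Real.rpow_sub_one hx0.ne']
  ring

theorem rpow_eq_mul_sq {γ x : ℝ} (hx : 0 < x) : x ^ (γ - 2) = (x ^ (γ / 2 - 1)) ^ 2 := by
  rw [← Real.rpow_natCast, ← Real.rpow_mul hx.le]
  push_cast
  ring_nf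

theorem besselArg_mul_rpow {γ μ ν b x : ℝ} (hb : 0 < b) (hx : 0 < x) :
    besselArg γ μ ν b x * x ^ (γ - 2) = besselJFirstZero ν ^ 2 / (4 * b ^ (2 + μ - γ)) * x ^ μ := by
  rw [besselArg, Real.div_rpow hx.le hb.le, show x ^ μ = x ^ (2 + μ - γ) * x ^ (γ - 2) by
    rw [← Real.rpow_add hx]; ring_nf]
  field_simp

theorem hasDerivAt_coeffA0_mul_coeffA1 {γ μ ν b x : ℝ} (hν : 0 ≤ ν) (hμγ : 0 < 2 + μ - γ)
    (hx : x ∈ Ioo 0 b) :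
    HasDerivAt (fun y ↦ coeffA0 γ μ ν b y * coeffA1 γ y)
      (((1 - γ) ^ 2 - (2 + μ - γ) ^ 2 * ν ^ 2) / 4 * x ^ (γ - 2)
        + besselJFirstZero ν ^ 2 * (2 + μ - γ) ^ 2 / (4 * b ^ (2 + μ - γ)) * x ^ μ
        + coeffA0 γ μ ν b x ^ 2) x := by
  have hb : 0 < b := hx.1.trans hx.2
  have hx0 : 0 < x := hx.1
  -- Here `a₀ a₁ = ((γ - 1)/2 - q) x^(γ-1)`; the terms in `q` and `q²` of its derivative are exactly
  -- those of `a₀²`.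
  have d := ((hasDerivAt_besselQuot hν hμγ hx).const_sub ((γ - 1) / 2)).mul
    (Real.hasDerivAt_rpow_const (x := x) (p := γ - 1) (.inl hx0.ne'))
  refine (d.congr_of_eventuallyEq ?_).congr_deriv ?_
  · filter_upwards [Ioo_mem_nhds hx.1 hx.2] with y hy
    rw [coeffA0_eq hν hμγ hy, coeffA1, mul_assoc, ← Real.rpow_add hy.1]
    simp only [Pi.mul_apply]
    ring_nf
  · have h := besselArg_mul_rpow (γ := γ) (μ := μ) (ν := ν) hb hx0
    have h1 : x ^ (γ - 1) = x ^ (γ - 2) * x := by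
      rw [← Real.rpow_add_one hx0.ne']; ring_nf
    have h2 : besselJFirstZero ν ^ 2 * (2 + μ - γ) ^ 2 / (4 * b ^ (2 + μ - γ)) * x ^ μ =
        (2 + μ - γ) ^ 2 * (besselArg γ μ ν b x * x ^ (γ - 2)) := by
      rw [h]
      ring
    rw [h2, coeffA0_eq hν hμγ hx, mul_pow, ← rpow_eq_mul_sq hx0, h1,
      show γ - 1 - 1 = γ - 2 by ring]
    field_simp
    ring

/-! ### The integral inequality -/

/-- A singularity of `p` at an endpoint does no harm, because `g` vanishes near it. This supplies
all the integrability needed. -/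
theorem IsTestFunctionOn.continuous_mul_norm_sq {a b : ℝ} {f g : ℝ → ℂ} {p : ℝ → ℝ}
    (hf : IsTestFunctionOn a b f) (hp : ContinuousOn p (Ioo a b)) (hg : Continuous g)
    (hgf : tsupport g ⊆ tsupport f) : Continuous fun x ↦ p x * ‖g x‖ ^ 2 := by
  refine continuous_of_tsupport fun x hx ↦ ?_
  have hxg : x ∈ tsupport g := by
    refine closure_mono (fun y hy ↦ ?_) hx
    rw [Function.mem_support] at hy ⊢
    contrapose! hy
    simp [hy]
  exact (hp.continuousAt (isOpen_Ioo.mem_nhds (hf.2.2 (hgf hxg)))).mul (hg.norm.pow 2).continuousAt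

/-- This is `‖a w + c z‖² ≥ 0`, expanded. -/
theorem neg_two_mul_mul_inner_le (a c : ℝ) (z w : ℂ) :
    -(a * c * (2 * inner ℝ z w)) ≤ a ^ 2 * ‖w‖ ^ 2 + c ^ 2 * ‖z‖ ^ 2 := by
  have h1 : |a * c * inner ℝ z w| ≤ |a * c| * (‖z‖ * ‖w‖) := by
    rw [abs_mul]
    gcongr
    exact abs_real_inner_le_norm z w
  have h2 := neg_abs_le (a * c * inner ℝ z w)
  rw [abs_mul a c] at h1
  have h3 := sq_nonneg (|a| * ‖w‖ - |c| * ‖z‖)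
  have h4 : (|a| * ‖w‖ - |c| * ‖z‖) ^ 2
      = a ^ 2 * ‖w‖ ^ 2 + c ^ 2 * ‖z‖ ^ 2 - 2 * (|a| * |c| * (‖z‖ * ‖w‖)) := by
    rw [← sq_abs a, ← sq_abs c]
    ring
  linarith

/-- The factorization method: a first order factor `a₁ d/dx + a₀` bounds the Dirichlet-type form
`∫ a₁² |f'|²` from below by `∫ (-a₀² + (a₀ a₁)') |f|²`. -/
theorem IsTestFunctionOn.integral_factorization_nonneg {a b : ℝ} {f : ℝ → ℂ}
    {a₀ a₁ P : ℝ → ℝ} (hab : a ≤ b) (hf : IsTestFunctionOn a b f)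
    (ha₁ : ContinuousOn a₁ (Ioo a b)) (hP : ContinuousOn P (Ioo a b))
    (hd : ∀ x ∈ Ioo a b, HasDerivAt (fun y ↦ a₀ y * a₁ y) (P x + a₀ x ^ 2) x) :
    0 ≤ ∫ x in a..b, (a₁ x ^ 2 * ‖deriv f x‖ ^ 2 - P x * ‖f x‖ ^ 2) := by
  have hdf : Continuous (deriv f) := hf.1.continuous_deriv (by simp)
  have hdiff : Differentiable ℝ f := hf.1.differentiable (by simp)
  have c1 := hf.continuous_mul_norm_sq (ha₁.pow 2) hdf tsupport_deriv_subset
  have c2 := hf.continuous_mul_norm_sq hP hf.1.continuous subset_rfl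
  have c3 := hf.continuous_mul_norm_sq (p := fun y ↦ a₀ y * a₁ y)
    (fun x hx ↦ (hd x hx).continuousAt.continuousWithinAt) hf.1.continuous subset_rfl
  -- Integration by parts as an inequality: `-(a₀ a₁ |f|²)` has derivative at most `φ`, so only `φ`
  -- has to be integrable and `a₀` need not be continuous.
  have key := intervalIntegral.sub_le_integral_of_hasDeriv_right_of_le hab
    (g := fun x ↦ -(a₀ x * a₁ x * ‖f x‖ ^ 2))
    (g' := fun x ↦ -((P x + a₀ x ^ 2) * ‖f x‖ ^ 2
      + a₀ x * a₁ x * (2 * inner ℝ (f x) (deriv f x))))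
    (φ := fun x ↦ a₁ x ^ 2 * ‖deriv f x‖ ^ 2 - P x * ‖f x‖ ^ 2)
    c3.neg.continuousOn
    (fun x hx ↦ ((hd x hx).mul (hdiff x).hasDerivAt.norm_sq).neg.hasDerivWithinAt)
    (c1.sub c2).continuousOn.integrableOn_Icc (fun x _ ↦ ?_)
  · have h0 (x : ℝ) (hx : x ∉ Ioo a b) : f x = 0 :=
      image_eq_zero_of_notMem_tsupport fun h ↦ hx (hf.2.2 h)
    simpa [h0 a (by simp), h0 b (by simp)] using key
  · have := neg_two_mul_mul_inner_le (a₁ x) (a₀ x) (f x) (deriv f x)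
    linarith

theorem hardy_besselJ_inequality {γ μ ν b : ℝ} (hν : 0 ≤ ν) (hμγ : 0 < 2 + μ - γ) (hb : 0 < b)
    {f : ℝ → ℂ} (hf : IsTestFunctionOn 0 b f) :
    ((1 - γ) ^ 2 - (2 + μ - γ) ^ 2 * ν ^ 2) / 4 * (∫ x in Ioo 0 b, x ^ (γ - 2) * ‖f x‖ ^ 2)
        + besselJFirstZero ν ^ 2 * (2 + μ - γ) ^ 2 / (4 * b ^ (2 + μ - γ)) *
          (∫ x in Ioo 0 b, x ^ μ * ‖f x‖ ^ 2)
      ≤ ∫ x in Ioo 0 b, x ^ γ * ‖deriv f x‖ ^ 2 := by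
  have hpow (p : ℝ) : ContinuousOn (fun x : ℝ ↦ x ^ p) (Ioo 0 b) := fun x hx ↦
    (Real.continuousAt_rpow_const x p (.inl hx.1.ne')).continuousWithinAt
  have hdf : Continuous (deriv f) := hf.1.continuous_deriv (by simp)
  have hint {F : ℝ → ℝ} (hF : Continuous F) : IntegrableOn F (Ioo 0 b) :=
    hF.integrableOn_Icc.mono_set Ioo_subset_Icc_self
  have i0 := hint (hf.continuous_mul_norm_sq (hpow γ) hdf tsupport_deriv_subset)
  have i1 := hint (hf.continuous_mul_norm_sq (hpow (γ - 2)) hf.1.continuous subset_rfl)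
  have i2 := hint (hf.continuous_mul_norm_sq (hpow μ) hf.1.continuous subset_rfl)
  have key := hf.integral_factorization_nonneg hb.le (a₁ := coeffA1 γ) (hpow (γ / 2))
    (((hpow (γ - 2)).const_mul _).add ((hpow μ).const_mul _))
    (fun x hx ↦ hasDerivAt_coeffA0_mul_coeffA1 hν hμγ hx)
  rw [intervalIntegral.integral_of_le hb.le, integral_Ioc_eq_integral_Ioo] at key
  rw [← integral_const_mul, ← integral_const_mul,
    ← integral_add (i1.const_mul _) (i2.const_mul _), ← sub_nonneg]
  refine (key.trans_eq (setIntegral_congr_fun measurableSet_Ioo fun x hx ↦ ?_)).trans_eq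
    (integral_sub i0 ((i1.const_mul _).add (i2.const_mul _)))
  have hsq : coeffA1 γ x ^ 2 = x ^ γ := by
    rw [coeffA1, ← Real.rpow_natCast, ← Real.rpow_mul hx.1.le]
    push_cast
    ring_nf
  simp only [hsq, Pi.add_apply]
  ring

theorem mainTheorem4 (γ μ ν b : ℝ) (hν : 0 ≤ ν) (hμγ : 0 < 2 + μ - γ) (hb : 0 < b) :
    -- `j_{ν,1}` is the least positive zero of `J_ν` (in particular, positive zeros exist)
    IsLeast (besselJPosZeros ν) (besselJFirstZero ν) ∧
    -- the integral inequality
    (∀ f : ℝ → ℂ, IsTestFunctionOn 0 b f →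
      ((1 - γ) ^ 2 - (2 + μ - γ) ^ 2 * ν ^ 2) / 4 *
            (∫ x in Ioo 0 b, x ^ (γ - 2) * ‖f x‖ ^ 2)
          + besselJFirstZero ν ^ 2 * (2 + μ - γ) ^ 2 / (4 * b ^ (2 + μ - γ)) *
            (∫ x in Ioo 0 b, x ^ μ * ‖f x‖ ^ 2)
        ≤ ∫ x in Ioo 0 b, x ^ γ * ‖deriv f x‖ ^ 2) ∧
    -- positivity of the first coefficient
    (ν < |1 - γ| / (2 + μ - γ) → 0 < ((1 - γ) ^ 2 - (2 + μ - γ) ^ 2 * ν ^ 2) / 4) ∧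
    -- the coefficients `a_0`, `a_1` are well defined on `(0,b)`, and `-a_0² + (a_0 a_1)'`
    -- is the weight on the smaller side of the inequality
    (∀ x ∈ Ioo 0 b,
      0 < scaledBesselJ γ μ ν b x ∧
      DifferentiableAt ℝ (scaledBesselJ γ μ ν b) x ∧
      DifferentiableAt ℝ (fun y => coeffA0 γ μ ν b y * coeffA1 γ y) x ∧
      -(coeffA0 γ μ ν b x) ^ 2 + deriv (fun y => coeffA0 γ μ ν b y * coeffA1 γ y) x
        = ((1 - γ) ^ 2 - (2 + μ - γ) ^ 2 * ν ^ 2) / 4 * x ^ (γ - 2)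
          + besselJFirstZero ν ^ 2 * (2 + μ - γ) ^ 2 / (4 * b ^ (2 + μ - γ)) * x ^ μ) := by
  refine ⟨isLeast_besselJFirstZero hν, fun f hf ↦ hardy_besselJ_inequality hν hμγ hb hf,
    fun h ↦ ?_, fun x hx ↦ ?_⟩
  · rw [lt_div_iff₀ hμγ] at h
    have h1 := pow_lt_pow_left₀ h (by positivity) two_ne_zero
    rw [sq_abs, mul_pow] at h1
    linarith
  · have h := hasDerivAt_coeffA0_mul_coeffA1 hν hμγ hx
    refine ⟨scaledBesselJ_pos hν hμγ hx, (hasDerivAt_scaledBesselJ hν hμγ hx).differentiableAt,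
      h.differentiableAt, ?_⟩
    rw [h.deriv]
    ring
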